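/- Let $\mathcal{T}=(Q,\Sigma,\delta)$ be the Grigorchuk automaton: $Q=\{a,b,c,d,\mathrm{id}\}$, $\Sigma=\{0,1\}$, with transitions (written $q\xrightarrow{x/y}p$ for state $q$, input $x$, output $y$, next state $p$) $$a\xrightarrow{0/1}\mathrm{id},\quad a\xrightarrow{1/0}\mathrm{id},\quad b\xrightarrow{0/0}a,\quad b\xrightarrow{1/1}c,\quad c\xrightarrow{0/0}a,\quad c\xrightarrow{1/1}d,\quad d\xrightarrow{0/0}\mathrm{id},\quad d\xrightarrow{1/1}b,\quad \mathrm{id}\xrightarrow{0/0}\mathrm{id},\quad \mathrm{id}\xrightarrow{1/1}\mathrm{id}.$$ An automaton is deterministic (complete) if for every state $q$ and letter $x$ there is at most (at least) one transition with source $q$ and input $x$; it is reversible if for every letter $x$ and state $p$ there is at most one transition with input $x$ and target $p$; it is inverse-deterministic if exchanging the input and the output of every transition yields a deterministic automaton. In a deterministic automaton every state $q$ induces a partial, length-preserving map $q\,\circ$ on finite and right-infinite words over its alphabet (start in $q$, read the word, and write the outputs), and a sequence $q_n\cdots q_1$ of states induces the composition $q_n\circ\cdots\circ q_1\,\circ$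 (the empty sequence induces the identity). The semigroup generated by the automaton consists of the maps induced by the non-empty state sequences; the group generated by a complete, deterministic and inverse-deterministic automaton is the semigroup generated by the disjoint union of the automaton and its inverse. The orbit of a word is the set of its images under all finite state sequences. The dual $\partial\mathcal{T}=(Q',\Sigma',\delta')$ has states $Q'=\Sigma$, alphabet $\Sigma'=Q$ and a transition $x\xrightarrow{q/p}y$ for every transition $q\xrightarrow{x/y}p$ of $\mathcal{T}$. Then: 1. $\mathcal{T}$ is complete, deterministic and inverse-deterministic, and the group it generates is (isomorphic to) the Grigorchuk group, that is, the group of permutations of $\{0,1\}^*$ generated by $a,b,c,d$, which fix the empty word and satisfy $a(0w)=1w$, $a(1w)=0w$, $b(0w)=0\,a(w)$, $b(1w)=1\,c(w)$, $c(0w)=0\,a(w)$, $c(1w)=1\,d(w)$, $d(0w)=0w$, $d(1w)=1\,b(w)$. 2. The dual $\partial\mathcal{T}$ is the deterministic, complete and reversible automaton with the transitions $$0\xrightarrow{\mathrm{id}/\mathrm{id}}0,\quad 0\xrightarrow{b/a}0,\quad 0\xrightarrow{c/a}0,\quad 0\xrightarrow{d/\mathrm{id}}0,\quad 0\xrightarrow{a/\mathrm{id}}1,$$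 $$1\xrightarrow{\mathrm{id}/\mathrm{id}}1,\quad 1\xrightarrow{b/c}1,\quad 1\xrightarrow{c/d}1,\quad 1\xrightarrow{d/b}1,\quad 1\xrightarrow{a/\mathrm{id}}0.$$ 3. The semigroup generated by $\partial\mathcal{T}$ is infinite. 4. For every finite word $\boldsymbol{p}\in Q^*$ and every non-empty finite word $\boldsymbol{q}\in Q^+$, the orbit of the ultimately periodic word $\boldsymbol{p}\boldsymbol{q}^\omega$ under $\partial\mathcal{T}$ is finite. -/

import Mathlib

/-- An automaton (letter-to-letter transducer) with state set `Q` and alphabet `A`: a set of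
transitions `(q, a, b, p)`, read as `q --a/b--> p` (input `a`, output `b`). -/
@[ext]
structure Automaton (Q A : Type*) where
  δ : Set (Q × A × A × Q)

/-- Finite words and `ω`-words over `A`. -/
abbrev Word (A : Type*) : Type _ := List A ⊕ Stream' A

/-- Partial functions from `X` to itself, as a semigroup under composition: `f * g` is
`f` after `g`. -/
def PartialMap (X : Type*) : Type _ := X →. X

instance (X : Type*) : Semigroup (PartialMap X) where
  mul f g := PFun.comp f g
  mul_assoc f g h := PFun.comp_assoc f g h

namespace Automaton

variable {Q Q' A : Type*}

/-- Every `q`, `a` admit at least one transition with source `q` and input `a`. -/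
def Complete (T : Automaton Q A) : Prop :=
  ∀ (q : Q) (a : A), 1 ≤ {t ∈ T.δ | ∃ (b : A) (p : Q), t = (q, a, b, p)}.encard

/-- Every `q`, `a` admit at most one transition with source `q` and input `a`;
these are the `S`-automata. -/
def Deterministic (T : Automaton Q A) : Prop :=
  ∀ (q : Q) (a : A), {t ∈ T.δ | ∃ (b : A) (p : Q), t = (q, a, b, p)}.encard ≤ 1

/-- Every `a`, `p` admit at most one transition with input `a` and target `p`. -/
def Reversible (T : Automaton Q A) : Prop :=
  ∀ (a : A) (p : Q), {t ∈ T.δ | ∃ (q : Q) (b : A), t = (q, a, b, p)}.encard ≤ 1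

/-- The dual automaton: `a --q/p--> b` for every `q --a/b--> p`. -/
def dual (T : Automaton Q A) : Automaton A Q where
  δ := {t | ∃ (q : Q) (a b : A) (p : Q), (q, a, b, p) ∈ T.δ ∧ t = (a, q, p, b)}

/-- The inverse automaton, with inputs and outputs exchanged. -/
def inverse (T : Automaton Q A) : Automaton Q A where
  δ := {t | ∃ (q : Q) (a b : A) (p : Q), (q, a, b, p) ∈ T.δ ∧ t = (q, b, a, p)}

/-- The disjoint union of two automata over the same alphabet. -/
def disjointUnion (T : Automaton Q A) (T' : Automaton Q' A) : Automaton (Q ⊕ Q') A where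
  δ := {t | (∃ (q : Q) (a b : A) (p : Q), (q, a, b, p) ∈ T.δ ∧ t = (.inl q, a, b, .inl p)) ∨
    ∃ (q : Q') (a b : A) (p : Q'), (q, a, b, p) ∈ T'.δ ∧ t = (.inr q, a, b, .inr p)}

/-- Complete, inverse-deterministic `S`-automata. -/
def IsGAutomaton (T : Automaton Q A) : Prop :=
  T.Deterministic ∧ T.Complete ∧ T.inverse.Deterministic

/-- `T.Path q u v p`: starting in `q` and reading `u`, the automaton can output `v` and
end in `p`. -/
inductive Path (T : Automaton Q A) : Q → List A → List A → Q → Prop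
  | nil (q : Q) : Path T q [] [] q
  | cons {q p r : Q} {a b : A} {u v : List A} :
      (q, a, b, p) ∈ T.δ → Path T p u v r → Path T q (a :: u) (b :: v) r

/-- `T.MapsTo q w w'`: the state `q` maps the word `w` to `w'`. On `ω`-words this means
that every finite prefix of `w` is mapped to the prefix of `w'` of the same length. -/
def MapsTo (T : Automaton Q A) (q : Q) : Word A → Word A → Prop
  | .inl u, .inl v => ∃ p, T.Path q u v p
  | .inr ξ, .inr η => ∀ m : ℕ, ∃ p, T.Path q (ξ.take m) (η.take m) p
  | _, _ => False

open Classical in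
/-- The partial function `q ∘` on words induced by a state `q`. The image of a word is unique
if the automaton is deterministic. -/
noncomputable def stateMap (T : Automaton Q A) (q : Q) : PartialMap (Word A) :=
  fun w => ⟨∃ w', T.MapsTo q w w', fun h => h.choose⟩

/-- The partial function `qₙ ∘ ⋯ ∘ q₁` induced by the state sequence `[qₙ, …, q₁]`. -/
noncomputable def act (T : Automaton Q A) : List Q → PartialMap (Word A)
  | [] => PFun.id (Word A)
  | q :: qs => T.stateMap q * T.act qs

theorem act_append (T : Automaton Q A) (u v : List Q) :
    T.act (u ++ v) = T.act u * T.act v := by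
  induction u with
  | nil => exact (PFun.id_comp _).symm
  | cons q u ih => simp only [List.cons_append, act, ih, mul_assoc]

/-- The semigroup generated by an `S`-automaton: the partial functions induced by non-empty state
sequences. -/
noncomputable def generatedSemigroup (T : Automaton Q A) : Subsemigroup (PartialMap (Word A)) where
  carrier := {f | ∃ qs : List Q, qs ≠ [] ∧ f = T.act qs}
  mul_mem' := by
    rintro _ _ ⟨u, hu, rfl⟩ ⟨v, _, rfl⟩
    exact ⟨u ++ v, by simp [hu], (T.act_append u v).symm⟩

/-- The group generated by a `G`-automaton: the semigroup generated by the disjoint union of the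
automaton and its inverse. -/
noncomputable def generatedGroup (T : Automaton Q A) : Subsemigroup (PartialMap (Word A)) :=
  (T.disjointUnion T.inverse).generatedSemigroup

/-- The orbit of a word under all (possibly empty) state sequences. -/
def orbit (T : Automaton Q A) (w : Word A) : Set (Word A) :=
  {w' | ∃ qs : List Q, w' ∈ T.act qs w}

end Automaton

/-- The states of the Grigorchuk automaton; `e` is the identity state. -/
inductive GrigState
  | a | b | c | d | e
  deriving DecidableEq

open GrigState in
/-- The Grigorchuk automaton. -/
def grigAutomaton : Automaton GrigState (Fin 2) where
  δ := {(a, 0, 1, e), (a, 1, 0, e), (b, 0, 0, a), (b, 1, 1, c), (c, 0, 0, a), (c, 1, 1, d),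
    (d, 0, 0, e), (d, 1, 1, b), (e, 0, 0, e), (e, 1, 1, e)}

open GrigState in
/-- The automaton with states `0`, `1` depicted as the dual of the Grigorchuk automaton. -/
def grigDualAutomaton : Automaton (Fin 2) GrigState where
  δ := {(0, e, e, 0), (0, b, a, 0), (0, c, a, 0), (0, d, e, 0), (0, a, e, 1),
    (1, e, e, 1), (1, b, c, 1), (1, c, d, 1), (1, d, b, 1), (1, a, e, 0)}

/-! The Grigorchuk group, as the group of permutations of the vertices of the rooted binary tree
generated by `a`, `b`, `c`, `d`, where `a` exchanges the two subtrees below the root and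
`b = (a, c)`, `c = (a, d)`, `d = (1, b)`. -/

def grigA : List (Fin 2) → List (Fin 2)
  | [] => []
  | x :: w => (1 - x) :: w

mutual
  def grigB : List (Fin 2) → List (Fin 2)
    | [] => []
    | 0 :: w => 0 :: grigA w
    | 1 :: w => 1 :: grigC w
  def grigC : List (Fin 2) → List (Fin 2)
    | [] => []
    | 0 :: w => 0 :: grigA w
    | 1 :: w => 1 :: grigD w
  def grigD : List (Fin 2) → List (Fin 2)
    | [] => []
    | 0 :: w => 0 :: w
    | 1 :: w => 1 :: grigB w
end

theorem grigA_involutive : Function.Involutive grigA := by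
  rintro (_ | ⟨x, w⟩) <;> simp [grigA]

theorem grigBCD_involutive (w : List (Fin 2)) :
    grigB (grigB w) = w ∧ grigC (grigC w) = w ∧ grigD (grigD w) = w := by
  induction w with
  | nil => simp [grigB, grigC, grigD]
  | cons x w ih =>
    obtain ⟨hb, hc, hd⟩ := ih
    have ha := grigA_involutive w
    match x with
    | 0 => simp [grigB, grigC, grigD, ha]
    | 1 => simp [grigB, grigC, grigD, hb, hc, hd]

/-- The Grigorchuk group. -/
def grigorchukGroup : Subgroup (Equiv.Perm (List (Fin 2))) :=
  Subgroup.closure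
    {grigA_involutive.toPerm,
      Function.Involutive.toPerm grigB fun w => (grigBCD_involutive w).1,
      Function.Involutive.toPerm grigC fun w => (grigBCD_involutive w).2.1,
      Function.Involutive.toPerm grigD fun w => (grigBCD_involutive w).2.2}

-- Both automata have exactly one transition per state and input, so they are Mealy machines and all
-- induced maps are total. Reading a state word `w` on a letter `x` in the dual gives the image of
-- `x` under `w` (`img`) and the section of `w` at `x` (`sec`), where `run w` is the permutation
-- represented by `w`, first letter acting first.
--
-- Finite orbits come from torsion. If `q` has order `n`, then `q` repeated `n` times is a period
-- `v` with `run v = 1`. Such a `v` fixes every letter, so a dual state returns to itself after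
-- reading `v`; it outputs a period of the same length that again represents the identity. Preperiod
-- and period lengths are thus preserved, and only finitely many words remain
-- (`wordMap_mem_periodicWords`, `finite_orbit`). Torsion itself (`isOfFinOrder_run`) is by
-- induction on a weight that drops when a cyclically reduced word is replaced by its sections.
--
-- The dual semigroup is infinite because the group is: a group element is determined by the
-- first-level images of its iterated sections, and a finite dual semigroup would leave finitely
-- many such tables (`infinite_generatedSemigroup_dual`).
--
-- The automaton equals its own inverse, so the disjoint union adds no new maps, and these maps are
-- determined on finite words.

-- Mealy machines and the maps they induce

/-- A Mealy machine: an automaton with exactly one transition for every state and input. -/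
structure Mealy (Q A : Type*) where
  out : Q → A → A
  nxt : Q → A → Q

namespace Mealy

variable {Q A : Type*} (M : Mealy Q A)

/-- The automaton with the transitions `q --a/out q a--> nxt q a`. -/
def toAutomaton : Automaton Q A where
  δ := {t | t.2.2 = (M.out t.1 t.2.1, M.nxt t.1 t.2.1)}

/-- The dual machine. -/
def dual : Mealy A Q where
  out a q := M.nxt q a
  nxt a q := M.out q a

/-- The word written when reading a finite word. -/
def wordOut : Q → List A → List A
  | _, [] => []
  | q, a :: u => M.out q a :: wordOut (M.nxt q a) u

/-- The state reached after reading a finite word. -/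
def target : Q → List A → Q
  | q, [] => q
  | q, a :: u => target (M.nxt q a) u

/-- The stream written when reading a stream. -/
def streamOut (q : Q) (ξ : Stream' A) : Stream' A :=
  fun n => M.out (M.target q (ξ.take n)) (ξ.get n)

/-- The map on finite and infinite words induced by a state. -/
def wordMap (q : Q) : Word A → Word A
  | .inl u => .inl (M.wordOut q u)
  | .inr ξ => .inr (M.streamOut q ξ)

/-- The map on finite and infinite words induced by a state sequence. -/
def seqMap (qs : List Q) (w : Word A) : Word A :=
  qs.foldr M.wordMap w

@[simp] theorem mem_toAutomaton {q p : Q} {a b : A} :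
    (q, a, b, p) ∈ M.toAutomaton.δ ↔ b = M.out q a ∧ p = M.nxt q a := by
  simp [toAutomaton]

theorem toAutomaton_deterministic : M.toAutomaton.Deterministic := by
  intro q a
  rw [Set.encard_le_one_iff]
  rintro _ _ ⟨h₁, b, p, rfl⟩ ⟨h₂, b', p', rfl⟩
  rw [mem_toAutomaton] at h₁ h₂
  rw [h₁.1, h₁.2, h₂.1, h₂.2]

theorem toAutomaton_complete : M.toAutomaton.Complete := by
  intro q a
  rw [Set.one_le_encard_iff_nonempty]
  exact ⟨(q, a, M.out q a, M.nxt q a), by simp, _, _, rfl⟩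

theorem toAutomaton_dual : M.toAutomaton.dual = M.dual.toAutomaton := by
  ext ⟨a, q, p, b⟩
  rw [mem_toAutomaton]
  constructor
  · rintro ⟨q', a', b', p', h, h'⟩
    simp only [Prod.mk.injEq] at h'
    obtain ⟨rfl, rfl, rfl, rfl⟩ := h'
    exact ((mem_toAutomaton M).1 h).symm
  · rintro ⟨rfl, rfl⟩
    exact ⟨q, a, _, _, (mem_toAutomaton M).2 ⟨rfl, rfl⟩, rfl⟩

theorem path_iff {q p : Q} {u v : List A} :
    M.toAutomaton.Path q u v p ↔ v = M.wordOut q u ∧ p = M.target q u := by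
  constructor
  · intro h
    induction h with
    | nil q => exact ⟨rfl, rfl⟩
    | cons h _ ih =>
      obtain ⟨rfl, rfl⟩ := (mem_toAutomaton M).1 h
      obtain ⟨rfl, rfl⟩ := ih
      exact ⟨rfl, rfl⟩
  · rintro ⟨rfl, rfl⟩
    induction u generalizing q with
    | nil => exact .nil q
    | cons a u ih => exact .cons ((mem_toAutomaton M).2 ⟨rfl, rfl⟩) ih

@[simp] theorem length_wordOut (q : Q) (u : List A) : (M.wordOut q u).length = u.length := by
  induction u generalizing q with
  | nil => rfl
  | cons a u ih => simp [wordOut, ih]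

theorem wordOut_append (q : Q) (u v : List A) :
    M.wordOut q (u ++ v) = M.wordOut q u ++ M.wordOut (M.target q u) v := by
  induction u generalizing q with
  | nil => rfl
  | cons a u ih => simp [wordOut, target, ih]

theorem target_append (q : Q) (u v : List A) :
    M.target q (u ++ v) = M.target (M.target q u) v := by
  induction u generalizing q with
  | nil => rfl
  | cons a u ih => simp [target, ih]

theorem take_streamOut (q : Q) (ξ : Stream' A) (n : ℕ) :
    (M.streamOut q ξ).take n = M.wordOut q (ξ.take n) := by
  induction n with
  | zero => rfl
  | succ n ih =>
    rw [Stream'.take_succ', Stream'.take_succ', wordOut_append, ih]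
    rfl

theorem streamOut_append (q : Q) (u : List A) (ξ : Stream' A) :
    M.streamOut q (u ++ₛ ξ) = M.wordOut q u ++ₛ M.streamOut (M.target q u) ξ := by
  induction u generalizing q with
  | nil => rfl
  | cons a u ih =>
    rw [Stream'.cons_append_stream]
    simp only [wordOut, target, Stream'.cons_append_stream]
    rw [← ih]
    funext n
    cases n <;> rfl

theorem mapsTo_iff {q : Q} {w w' : Word A} :
    M.toAutomaton.MapsTo q w w' ↔ w' = M.wordMap q w := by
  rcases w with u | ξ <;> rcases w' with v | η <;>
    simp only [Automaton.MapsTo, wordMap, path_iff, exists_and_left, exists_eq, and_true,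
      Sum.inl.injEq, Sum.inr.injEq, reduceCtorEq]
  simp only [← take_streamOut]
  exact ⟨fun h => Stream'.take_theorem _ _ h, fun h m => by rw [h]⟩

/-- The image selected by choice in `stateMap` is harmless: `mapsTo_iff` leaves only one candidate.
-/
theorem stateMap_eq (q : Q) : M.toAutomaton.stateMap q = PFun.lift (M.wordMap q) := by
  refine PFun.ext fun w w' => ?_
  have h : ∃ w', M.toAutomaton.MapsTo q w w' := ⟨_, (mapsTo_iff M).2 rfl⟩
  have hc : h.choose = M.wordMap q w := (mapsTo_iff M).1 h.choose_spec
  simp only [Automaton.stateMap, PFun.coe_val, Part.mem_some_iff, Part.mem_mk_iff]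
  rw [← hc]
  exact ⟨fun ⟨_, h'⟩ => h'.symm, fun h' => ⟨h, h'.symm⟩⟩

theorem act_eq (qs : List Q) : M.toAutomaton.act qs = PFun.lift (M.seqMap qs) := by
  induction qs with
  | nil => rfl
  | cons q qs ih =>
    have : M.toAutomaton.act (q :: qs) =
      PFun.comp (M.toAutomaton.stateMap q) (M.toAutomaton.act qs) := rfl
    rw [this, ih, stateMap_eq]
    exact funext fun w => Part.bind_some _ _

theorem act_eq_iff {qs qs' : List Q} :
    M.toAutomaton.act qs = M.toAutomaton.act qs' ↔ M.seqMap qs = M.seqMap qs' := by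
  rw [act_eq, act_eq]
  exact PFun.lift_injective.eq_iff

theorem orbit_eq (w : Word A) : M.toAutomaton.orbit w = {w' | ∃ qs, w' = M.seqMap qs w} := by
  simp [Automaton.orbit, act_eq]

/-- The map on finite words induced by a state sequence. -/
def seqOut (qs : List Q) (u : List A) : List A :=
  qs.foldr M.wordOut u

theorem seqMap_inl (qs : List Q) (u : List A) : M.seqMap qs (.inl u) = .inl (M.seqOut qs u) := by
  induction qs with
  | nil => rfl
  | cons q qs ih =>
    change M.wordMap q (M.seqMap qs _) = _
    rw [ih]; rfl

theorem seqMap_inr (qs : List Q) (ξ : Stream' A) :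
    ∃ η, M.seqMap qs (.inr ξ) = .inr η ∧ ∀ n, η.take n = M.seqOut qs (ξ.take n) := by
  induction qs with
  | nil => exact ⟨ξ, rfl, fun _ => rfl⟩
  | cons q qs ih =>
    obtain ⟨η, h, h'⟩ := ih
    refine ⟨M.streamOut q η, ?_, fun n => ?_⟩
    · change M.wordMap q (M.seqMap qs _) = _
      rw [h]; rfl
    · rw [take_streamOut, h']; rfl

/-- The maps induced by state sequences are determined by their restriction to finite words. -/
theorem seqMap_eq_iff {qs qs' : List Q} :
    M.seqMap qs = M.seqMap qs' ↔ M.seqOut qs = M.seqOut qs' := by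
  constructor
  · intro h
    funext u
    simpa [seqMap_inl] using congrFun h (.inl u)
  · intro h
    funext w
    rcases w with u | ξ
    · rw [seqMap_inl, seqMap_inl, h]
    · obtain ⟨η, h₁, h₂⟩ := M.seqMap_inr qs ξ
      obtain ⟨η', h₁', h₂'⟩ := M.seqMap_inr qs' ξ
      rw [h₁, h₁', Stream'.take_theorem η η' fun n => by rw [h₂, h₂', h]]

/-- A state sequence, read from left to right, acts on `a :: u` through the dual machine. -/
theorem seqOut_reverse_cons (w : List Q) (a : A) (u : List A) :
    M.seqOut w.reverse (a :: u) =
      M.dual.target a w :: M.seqOut (M.dual.wordOut a w).reverse u := by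
  induction w generalizing a u with
  | nil => rfl
  | cons q w ih =>
    have h (v : List A) (q : Q) (w : List Q) :
        M.seqOut (q :: w).reverse v = M.seqOut w.reverse (M.wordOut q v) := by
      simp [seqOut]
    rw [h, wordOut, ih, target, wordOut, h]
    rfl

end Mealy

-- The Grigorchuk automaton, its inverse and its dual

namespace GrigState

/-- The output function of the Grigorchuk automaton. -/
def out : GrigState → Fin 2 → Fin 2
  | a, x => 1 - x
  | _, x => x

/-- The transition function of the Grigorchuk automaton. -/
def nxt : GrigState → Fin 2 → GrigState
  | a, _ => e
  | b, 0 => a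
  | b, 1 => c
  | c, 0 => a
  | c, 1 => d
  | d, 0 => e
  | d, 1 => b
  | e, _ => e

/-- The permutation of the rooted binary tree induced by a state. -/
def perm : GrigState → Equiv.Perm (List (Fin 2))
  | a => grigA_involutive.toPerm
  | b => Function.Involutive.toPerm grigB fun w => (grigBCD_involutive w).1
  | c => Function.Involutive.toPerm grigC fun w => (grigBCD_involutive w).2.1
  | d => Function.Involutive.toPerm grigD fun w => (grigBCD_involutive w).2.2
  | e => 1

end GrigState

open GrigState

/-- The Grigorchuk automaton as a Mealy machine. -/
def grigMealy : Mealy GrigState (Fin 2) where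
  out := GrigState.out
  nxt := GrigState.nxt

theorem grigAutomaton_eq : grigAutomaton = grigMealy.toAutomaton := by
  ext ⟨q, x, y, p⟩
  rw [Mealy.mem_toAutomaton]
  cases q <;> fin_cases x <;> fin_cases y <;> cases p <;>
    simp [grigAutomaton, grigMealy, GrigState.out, GrigState.nxt]

theorem grigDualAutomaton_eq : grigDualAutomaton = grigMealy.dual.toAutomaton := by
  ext ⟨x, q, p, y⟩
  rw [Mealy.mem_toAutomaton]
  cases q <;> fin_cases x <;> fin_cases y <;> cases p <;>
    simp [grigDualAutomaton, grigMealy, Mealy.dual, GrigState.out, GrigState.nxt]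

theorem grigAutomaton_inverse : grigAutomaton.inverse = grigAutomaton := by
  have h (q : GrigState) (x y : Fin 2) (p : GrigState) :
      (q, y, x, p) ∈ grigAutomaton.δ ↔ (q, x, y, p) ∈ grigAutomaton.δ := by
    rw [grigAutomaton_eq, Mealy.mem_toAutomaton, Mealy.mem_toAutomaton]
    cases q <;> fin_cases x <;> fin_cases y <;> cases p <;>
      simp [grigMealy, GrigState.out, GrigState.nxt]
  ext ⟨q, x, y, p⟩
  constructor
  · rintro ⟨q', x', y', p', h₁, h₂⟩
    simp only [Prod.mk.injEq] at h₂
    obtain ⟨rfl, rfl, rfl, rfl⟩ := h₂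
    exact (h _ _ _ _).2 h₁
  · exact fun h₁ => ⟨q, y, x, p, (h _ _ _ _).2 h₁, rfl⟩

/-- Each state of the Grigorchuk automaton permutes the two letters, so input and target in the dual
determine the source. -/
theorem grigDualAutomaton_reversible : grigDualAutomaton.Reversible := by
  intro q x
  rw [Set.encard_le_one_iff]
  rintro _ _ ⟨h₁, y, p, rfl⟩ ⟨h₂, y', p', rfl⟩
  rw [grigDualAutomaton_eq, Mealy.mem_toAutomaton] at h₁ h₂
  obtain ⟨rfl, h₁⟩ := h₁
  obtain ⟨rfl, h₂⟩ := h₂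
  have : y = y' := by
    rw [h₁] at h₂
    revert h₂
    cases q <;> fin_cases y <;> fin_cases y' <;>
      simp [grigMealy, Mealy.dual, GrigState.out]
  rw [this]

theorem GrigState.perm_apply (q : GrigState) (u : List (Fin 2)) :
    q.perm u = grigMealy.wordOut q u := by
  have he (u : List (Fin 2)) : grigMealy.wordOut e u = u := by
    induction u with
    | nil => rfl
    | cons x u ih =>
      change x :: grigMealy.wordOut e u = _
      rw [ih]
  have ha (u : List (Fin 2)) : grigMealy.wordOut a u = grigA u := by
    cases u with
    | nil => rfl
    | cons x u =>
      change (1 - x) :: grigMealy.wordOut e u = _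
      rw [he]; rfl
  have h : grigMealy.wordOut b u = grigB u ∧ grigMealy.wordOut c u = grigC u ∧
      grigMealy.wordOut d u = grigD u := by
    induction u with
    | nil => simp [Mealy.wordOut, grigB, grigC, grigD]
    | cons x u ih =>
      match x with
      | 0 => exact ⟨congrArg (0 :: ·) (ha u), congrArg (0 :: ·) (ha u), congrArg (0 :: ·) (he u)⟩
      | 1 => exact ⟨congrArg (1 :: ·) ih.2.1, congrArg (1 :: ·) ih.2.2, congrArg (1 :: ·) ih.1⟩
  cases q
  exacts [(ha u).symm, h.1.symm, h.2.1.symm, h.2.2.symm, (he u).symm]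

-- Permutations represented by words, and their sections

namespace Grig

/-- The product of the permutations of a state sequence, the last one acting first. -/
def prod (w : List GrigState) : Equiv.Perm (List (Fin 2)) := (w.map perm).prod

/-- The product of the permutations of a state sequence, the first one acting first. -/
def run (w : List GrigState) : Equiv.Perm (List (Fin 2)) := prod w.reverse

/-- The image of a letter under a state sequence, the first one acting first. -/
abbrev img (x : Fin 2) (w : List GrigState) : Fin 2 := grigMealy.dual.target x w

/-- The section of a state sequence at a letter. -/
abbrev sec (x : Fin 2) (w : List GrigState) : List GrigState := grigMealy.dual.wordOut x w

theorem prod_apply (w : List GrigState) (u : List (Fin 2)) :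
    prod w u = grigMealy.seqOut w u := by
  induction w with
  | nil => rfl
  | cons q w ih =>
    simp only [prod, List.map_cons, List.prod_cons, Equiv.Perm.mul_apply] at ih ⊢
    rw [ih, perm_apply]; rfl

theorem run_append (v w : List GrigState) : run (v ++ w) = run w * run v := by
  simp [run, prod]

theorem run_cons (q : GrigState) (w : List GrigState) : run (q :: w) = run w * q.perm := by
  simp [run, prod]

theorem run_apply_nil (w : List GrigState) : run w [] = [] := by
  have h := prod_apply w.reverse []
  rw [run, h, ← List.length_eq_zero_iff]
  generalize w.reverse = v
  induction v with
  | nil => rfl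
  | cons q v ih =>
    change (grigMealy.wordOut q _).length = 0
    rw [Mealy.length_wordOut, ← ih]
    rfl

theorem run_apply_cons (w : List GrigState) (x : Fin 2) (u : List (Fin 2)) :
    run w (x :: u) = img x w :: run (sec x w) u := by
  rw [run, prod_apply, Mealy.seqOut_reverse_cons, run, prod_apply]

theorem img_eq_of_run_eq {v w : List GrigState} (h : run v = run w) (x : Fin 2) :
    img x v = img x w := by
  have := congrArg (fun g => g [x]) h
  simp only [run_apply_cons, List.cons.injEq] at this
  exact this.1

theorem run_sec_eq_of_run_eq {v w : List GrigState} (h : run v = run w) (x : Fin 2) :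
    run (sec x v) = run (sec x w) := by
  ext1 u
  have := congrArg (fun g => g (x :: u)) h
  simp only [run_apply_cons, List.cons.injEq] at this
  exact this.2

theorem run_flatten_replicate (w : List GrigState) (n : ℕ) :
    run (List.replicate n w).flatten = run w ^ n := by
  induction n with
  | zero => rfl
  | succ n ih => rw [List.replicate_succ, List.flatten_cons, run_append, ih, pow_succ]

theorem run_pow_apply_cons {w : List GrigState} {x : Fin 2} (hx : img x w = x) (n : ℕ)
    (u : List (Fin 2)) : (run w ^ n) (x :: u) = x :: (run (sec x w) ^ n) u := by
  induction n generalizing u with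
  | zero => rfl
  | succ n ih => simp only [pow_succ, Equiv.Perm.mul_apply, run_apply_cons, hx, ih]

/-- When `w` fixes the first level, its powers act on each subtree by powers of the section there,
so the product of the two exponents kills both. -/
theorem isOfFinOrder_of_sec {w : List GrigState} (h : ∀ x, img x w = x)
    (h' : ∀ x, IsOfFinOrder (run (sec x w))) : IsOfFinOrder (run w) := by
  obtain ⟨m, hm, hm'⟩ := isOfFinOrder_iff_pow_eq_one.1 (h' 0)
  obtain ⟨n, hn, hn'⟩ := isOfFinOrder_iff_pow_eq_one.1 (h' 1)
  refine isOfFinOrder_iff_pow_eq_one.2 ⟨m * n, Nat.mul_pos hm hn, ?_⟩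
  ext1 u
  cases u with
  | nil => rw [← run_flatten_replicate, run_apply_nil]; rfl
  | cons x u =>
    rw [run_pow_apply_cons (h x)]
    match x with
    | 0 => rw [pow_mul, hm', one_pow]; rfl
    | 1 => rw [mul_comm, pow_mul, hn', one_pow]; rfl

theorem isOfFinOrder_run_append_comm {v w : List GrigState} :
    IsOfFinOrder (run (v ++ w)) ↔ IsOfFinOrder (run (w ++ v)) := by
  have h (v w : List GrigState) (hv : IsOfFinOrder (run (v ++ w))) :
      IsOfFinOrder (run (w ++ v)) := by
    obtain ⟨n, hn, hn'⟩ := isOfFinOrder_iff_pow_eq_one.1 hv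
    refine isOfFinOrder_iff_pow_eq_one.2 ⟨n, hn, ?_⟩
    have : run (w ++ v) = run v * run (v ++ w) * (run v)⁻¹ := by
      rw [run_append, run_append]; group
    rw [this, conj_pow, hn', mul_one, mul_inv_cancel]
  exact ⟨h v w, h w v⟩

-- Torsion: alternating words and weight reduction

/-- Multiplication in the Klein four-group `{e, b, c, d}`. -/
def mul : GrigState → GrigState → GrigState
  | e, y => y
  | x, e => x
  | b, c => d
  | c, b => d
  | b, d => c
  | d, b => c
  | c, d => b
  | d, c => b
  | _, _ => e

theorem perm_mul_self (q : GrigState) : q.perm * q.perm = 1 := by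
  ext1 u
  cases q
  exacts [grigA_involutive u, (grigBCD_involutive u).1, (grigBCD_involutive u).2.1,
    (grigBCD_involutive u).2.2, rfl]

theorem perm_b_mul_perm_c : b.perm * c.perm = d.perm := by
  have h (u : List (Fin 2)) : grigB (grigC u) = grigD u ∧ grigC (grigD u) = grigB u ∧
      grigD (grigB u) = grigC u := by
    induction u with
    | nil => simp [grigB, grigC, grigD]
    | cons x u ih =>
      match x with
      | 0 => simp [grigB, grigC, grigD, grigA_involutive u]
      | 1 => simp [grigB, grigC, grigD, ih]
  ext1 u
  exact (h u).1

theorem mul_ne_a {x y : GrigState} (hx : x ≠ a) (hy : y ≠ a) : mul x y ≠ a := by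
  revert hx hy
  cases x <;> cases y <;> simp [mul]

/-- Everything follows from `b`, `c`, `d` being involutions with `bc = d`. -/
theorem perm_mul {x y : GrigState} (hx : x ≠ a) (hy : y ≠ a) :
    (mul x y).perm = y.perm * x.perm := by
  have hb := perm_mul_self b
  have hc := perm_mul_self c
  have hbc := perm_b_mul_perm_c
  have hcb : c.perm * b.perm = d.perm := by
    rw [← inv_inj, mul_inv_rev, inv_eq_of_mul_eq_one_left hb, inv_eq_of_mul_eq_one_left hc, hbc,
      inv_eq_of_mul_eq_one_left (perm_mul_self d)]
  have hbd : b.perm * d.perm = c.perm := by rw [← hbc, ← mul_assoc, hb, one_mul]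
  have hcd : c.perm * d.perm = b.perm := by rw [← hcb, ← mul_assoc, hc, one_mul]
  have hdb : d.perm * b.perm = c.perm := by rw [← hcb, mul_assoc, hb, mul_one]
  have hdc : d.perm * c.perm = b.perm := by rw [← hbc, mul_assoc, hc, mul_one]
  have he : e.perm = 1 := rfl
  cases x <;> cases y <;>
    simp only [mul, he, one_mul, mul_one, hbc, hcb, hbd, hcd, hdb, hdc, perm_mul_self, ne_eq,
      not_true_eq_false] at hx hy ⊢

/-- Weights of the states for which the sections of alternating words get lighter. -/
def letterWeight : GrigState → ℕ
  | a => 3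
  | b => 4
  | c => 3
  | d => 2
  | e => 0

/-- The total weight of a state sequence. -/
def weight (w : List GrigState) : ℕ := (w.map letterWeight).sum

@[simp] theorem weight_nil : weight [] = 0 := rfl

@[simp] theorem weight_cons (q : GrigState) (w : List GrigState) :
    weight (q :: w) = letterWeight q + weight w := by simp [weight]

@[simp] theorem weight_append (v w : List GrigState) :
    weight (v ++ w) = weight v + weight w := by simp [weight]

theorem letterWeight_mul_le {x y : GrigState} (hx : x ≠ a) (hy : y ≠ a) :
    letterWeight (mul x y) ≤ letterWeight x + letterWeight y := by
  revert hx hy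
  cases x <;> cases y <;> simp [mul, letterWeight]

/-- The word that has an `a` in front of every letter of `l`. -/
def alt (l : List GrigState) : List GrigState := l.flatMap fun x => [a, x]

theorem alt_cons (x : GrigState) (l : List GrigState) : alt (x :: l) = a :: x :: alt l := rfl

theorem alt_append (l l' : List GrigState) : alt (l ++ l') = alt l ++ alt l' := by
  simp [alt]

/-- Every word represents the same permutation as an alternating one that is not heavier. -/
theorem exists_alt (w : List GrigState) :
    ∃ x l, x ≠ a ∧ (∀ y ∈ l, y ≠ a) ∧ run w = run (x :: alt l) ∧
      weight (x :: alt l) ≤ weight w := by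
  induction w with
  | nil => exact ⟨e, [], by simp, by simp, rfl, le_rfl⟩
  | cons q w ih =>
    obtain ⟨x, l, hx, hl, h₁, h₂⟩ := ih
    by_cases hq : q = a
    · subst hq
      -- The weightless `e` serves as the leading letter, so the weight does not grow.
      refine ⟨e, x :: l, by simp, ?_, ?_, ?_⟩
      · simpa using ⟨hx, hl⟩
      · rw [run_cons, h₁, run_cons e, alt_cons, run_cons a]; rfl
      · simp only [alt_cons, weight_cons] at h₂ ⊢
        simpa [letterWeight] using h₂
    · refine ⟨mul q x, l, mul_ne_a hq hx, hl, ?_, ?_⟩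
      · rw [run_cons, h₁, run_cons, run_cons, perm_mul hq hx, mul_assoc]
      · have := letterWeight_mul_le hq hx
        simp only [weight_cons] at h₂ ⊢
        omega

/-- Every word is conjugate to a letter or to an alternating word that is not heavier. -/
theorem exists_isOfFinOrder_iff (w : List GrigState) :
    IsOfFinOrder (run w) ∨ ∃ l ≠ [], (∀ y ∈ l, y ≠ a) ∧ weight (alt l) ≤ weight w ∧
      (IsOfFinOrder (run (alt l)) → IsOfFinOrder (run w)) := by
  obtain ⟨x, l, hx, hl, h₁, h₂⟩ := exists_alt w
  rcases List.eq_nil_or_concat l with rfl | ⟨l, y, rfl⟩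
  · left
    refine isOfFinOrder_iff_pow_eq_one.2 ⟨2, two_pos, ?_⟩
    rw [h₁, pow_two]
    exact perm_mul_self x
  · right
    rw [List.concat_eq_append] at *
    have hy : y ≠ a := hl y (by simp)
    -- Conjugation moves the leading `x` to the end, where it merges with the last letter `y`.
    refine ⟨l ++ [mul y x], by simp, ?_, ?_, fun h => ?_⟩
    · intro z hz
      rcases List.mem_append.1 hz with hz | hz
      · exact hl z (by simp [hz])
      · rw [List.mem_singleton.1 hz]
        exact mul_ne_a hy hx
    · have := letterWeight_mul_le hy hx
      simp only [alt_append, alt_cons, weight_append, weight_cons] at h₂ ⊢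
      omega
    · rw [h₁]
      change IsOfFinOrder (run ([x] ++ alt (l ++ [y])))
      rw [isOfFinOrder_run_append_comm]
      have : run (alt (l ++ [y]) ++ [x]) = run (alt (l ++ [mul y x])) := by
        simp only [alt_append, alt_cons, run_append, run_cons, perm_mul hy hx, mul_assoc]
        rfl
      rwa [this]

/-- Each `a` only swaps the roles of the two sections and leaves the weightless `e`; every other
letter sends one of its two successors to each section. The gain is at least 1 per pair `a x`. -/
theorem weight_sec_alt (l : List GrigState) (hl : ∀ y ∈ l, y ≠ a) :
    weight (sec 0 (alt l)) + weight (sec 1 (alt l)) + l.length ≤ weight (alt l) := by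
  induction l with
  | nil => simp [alt, Mealy.wordOut]
  | cons x l ih =>
    have ih := ih fun y hy => hl y (by simp [hy])
    have hx : x ≠ a := hl x (by simp)
    have h₀ : sec 0 (alt (x :: l)) = e :: x.nxt 1 :: sec (x.out 1) (alt l) := rfl
    have h₁ : sec 1 (alt (x :: l)) = e :: x.nxt 0 :: sec (x.out 0) (alt l) := rfl
    -- This is what dictates the weights: equality holds for `b`, `c` and `d`.
    have h : letterWeight (x.nxt 0) + letterWeight (x.nxt 1) + 1 ≤ 3 + letterWeight x := by
      revert hx
      cases x <;> simp [GrigState.nxt, letterWeight]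
    have ho : x.out 0 = 0 ∧ x.out 1 = 1 := by
      revert hx
      cases x <;> simp [GrigState.out]
    rw [h₀, h₁, ho.1, ho.2]
    simp only [alt_cons, weight_cons, List.length_cons]
    simp only [letterWeight] at h ⊢
    omega

theorem img_dichotomy (w : List GrigState) :
    (img 0 w = 0 ∧ img 1 w = 1) ∨ (img 0 w = 1 ∧ img 1 w = 0) := by
  have h : img 0 w ≠ img 1 w := fun h => by
    have : run w [0] = run w [1] := by
      rw [run_apply_cons, run_apply_cons, h, run_apply_nil, run_apply_nil]
    simpa using (run w).injective this
  revert h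
  generalize img 0 w = x
  generalize img 1 w = y
  revert x y
  decide

/-- The Grigorchuk group is a torsion group. -/
theorem isOfFinOrder_run (w : List GrigState) : IsOfFinOrder (run w) := by
  induction hn : weight w using Nat.strong_induction_on generalizing w with
  | _ n ih =>
  subst hn
  rcases exists_isOfFinOrder_iff w with h | ⟨l, hl, hla, hw, h⟩
  · exact h
  refine h ?_
  have hs := weight_sec_alt l hla
  simp only [sec] at hs
  have hlen := List.length_pos_iff.2 hl
  rcases img_dichotomy (alt l) with ⟨h₀, h₁⟩ | ⟨h₀, h₁⟩
  · refine isOfFinOrder_of_sec (fun x => ?_) fun x => ih _ ?_ _ rfl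
    · match x with
      | 0 => exact h₀
      | 1 => exact h₁
    · match x with
      | 0 => simp only [sec]; omega
      | 1 => simp only [sec]; omega
  -- If the letters are swapped, the square fixes them, and each of its sections is a product of
  -- both sections of `alt l`. `weight_sec_alt` bounds the sum of their weights, so the square is
  -- still covered by the induction.
  · refine IsOfFinOrder.of_pow (n := 2) ?_ two_ne_zero
    rw [pow_two, ← run_append]
    refine isOfFinOrder_of_sec (fun x => ?_) fun x => ih _ ?_ _ rfl
    · rw [img, Mealy.target_append]
      match x with
      | 0 => exact (congrArg (img · _) h₀).trans h₁
      | 1 => exact (congrArg (img · _) h₁).trans h₀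
    · rw [sec, Mealy.wordOut_append]
      match x with
      | 0 => rw [weight_append, show grigMealy.dual.target 0 (alt l) = 1 from h₀]; omega
      | 1 => rw [weight_append, show grigMealy.dual.target 1 (alt l) = 0 from h₁]; omega

end Grig

-- Finite orbits of ultimately periodic words

/-- A periodic stream is determined by its period. -/
theorem Stream'.eq_cycle {A : Type*} {s : Stream' A} {v : List A} (hv : v ≠ [])
    (h : s = v ++ₛ s) : s = Stream'.cycle v hv := by
  have key (n : ℕ) : ∀ s t : Stream' A, s = v ++ₛ s → t = v ++ₛ t → s.get n = t.get n := by
    induction n using Nat.strong_induction_on with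
    | _ n ih =>
    intro s t hs ht
    have hpos := List.length_pos_iff.2 hv
    rcases lt_or_ge n v.length with hn | hn
    · rw [hs, ht, Stream'.get_append_left _ _ _ hn, Stream'.get_append_left _ _ _ hn]
    · obtain ⟨k, rfl⟩ := Nat.exists_eq_add_of_le hn
      rw [hs, ht, Stream'.get_append_right, Stream'.get_append_right]
      exact ih k (by omega) s t hs ht
  exact Stream'.ext fun n => key n _ _ h (Stream'.cycle_eq v hv)

namespace Grig

/-- Infinite words with a preperiod of length `m` and a period of length `k`, where the period
represents the identity of the Grigorchuk group. -/
def periodicWords (m k : ℕ) : Set (Word GrigState) :=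
  {w | ∃ (u v : List GrigState) (hv : v ≠ []), u.length = m ∧ v.length = k ∧ run v = 1 ∧
    w = .inr (u ++ₛ Stream'.cycle v hv)}

instance : Finite GrigState :=
  Finite.of_surjective (fun i : Fin 5 => ![a, b, c, d, e] i) fun q => by
    cases q
    exacts [⟨0, rfl⟩, ⟨1, rfl⟩, ⟨2, rfl⟩, ⟨3, rfl⟩, ⟨4, rfl⟩]

theorem finite_periodicWords (m k : ℕ) : (periodicWords m k).Finite := by
  classical
  have h := (List.finite_length_eq GrigState m).prod (List.finite_length_eq GrigState k)
  -- `Stream'.cycle` needs a nonempty period; the value for an empty one is a dummy.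
  refine (h.image fun p => if hv : p.2 ≠ [] then
    (.inr (p.1 ++ₛ Stream'.cycle p.2 hv) : Word GrigState) else .inl []).subset ?_
  rintro _ ⟨u, v, hv, hu, hv', -, rfl⟩
  exact ⟨(u, v), ⟨hu, hv'⟩, dif_pos hv⟩

theorem img_eq_of_run_eq_one {v : List GrigState} (h : run v = 1) (x : Fin 2) : img x v = x :=
  img_eq_of_run_eq (w := []) h x

theorem run_sec_eq_one {v : List GrigState} (h : run v = 1) (x : Fin 2) : run (sec x v) = 1 :=
  run_sec_eq_of_run_eq (w := []) h x

/-- After the preperiod the dual machine is in state `img x u`. The period fixes this letter, so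
every copy of `v` is read from the same state and the output is periodic too. -/
theorem wordMap_mem_periodicWords {m k : ℕ} {w : Word GrigState} (hw : w ∈ periodicWords m k)
    (x : Fin 2) : grigMealy.dual.wordMap x w ∈ periodicWords m k := by
  obtain ⟨u, v, hv, hu, hvk, h, rfl⟩ := hw
  have hs : sec (img x u) v ≠ [] := by
    rw [← List.length_pos_iff, Mealy.length_wordOut]
    exact List.length_pos_iff.2 hv
  refine ⟨sec x u, sec (img x u) v, hs, by simp [hu], by simp [hvk], run_sec_eq_one h _, ?_⟩
  rw [Mealy.wordMap, Mealy.streamOut_append]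
  congr 2
  refine Stream'.eq_cycle hs ?_
  conv_lhs => rw [Stream'.cycle_eq, Mealy.streamOut_append]
  rw [show grigMealy.dual.target (img x u) v = img x u from img_eq_of_run_eq_one h _]

theorem finite_orbit (p q : List GrigState) (hq : q ≠ []) :
    (grigMealy.dual.toAutomaton.orbit (.inr (p ++ₛ Stream'.cycle q hq))).Finite := by
  obtain ⟨n, hn, hn'⟩ := isOfFinOrder_iff_pow_eq_one.1 (isOfFinOrder_run q)
  have hv : (List.replicate n q).flatten ≠ [] := by
    simpa [List.flatten_eq_nil_iff, hn.ne'] using hq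
  have h0 : (.inr (p ++ₛ Stream'.cycle q hq) : Word GrigState) ∈
      periodicWords p.length (List.replicate n q).flatten.length := by
    refine ⟨p, _, hv, rfl, rfl, by rw [run_flatten_replicate, hn'], ?_⟩
    congr 2
    refine Stream'.eq_cycle hv ?_
    clear hv hn' hn
    induction n with
    | zero => rfl
    | succ n ih =>
      rw [List.replicate_succ, List.flatten_cons, Stream'.append_append_stream, ← ih]
      exact Stream'.cycle_eq q hq
  refine (finite_periodicWords p.length (List.replicate n q).flatten.length).subset ?_
  rw [Mealy.orbit_eq]
  rintro _ ⟨xs, rfl⟩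
  induction xs with
  | nil => exact h0
  | cons x xs ih => exact wordMap_mem_periodicWords ih x

-- Infiniteness of the group and of the dual semigroup

/-- A word that fixes the letter `1` and whose section at `1` is `w`, up to `e`. -/
def lift (w : List GrigState) : List GrigState :=
  w.flatMap fun
    | a => [a, b, a]
    | b => [d]
    | c => [b]
    | d => [c]
    | e => [e]

theorem run_lift_apply (w : List GrigState) (u : List (Fin 2)) :
    run (lift w) (1 :: u) = 1 :: run w u := by
  induction w generalizing u with
  | nil => rfl
  | cons q w ih =>
    have h : lift (q :: w) = lift [q] ++ lift w := by simp [lift]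
    have h' : run (lift [q]) (1 :: u) = 1 :: q.perm u := by
      cases q <;> rfl
    rw [h, run_append, Equiv.Perm.mul_apply, h', ih, run_cons, Equiv.Perm.mul_apply]

/-- Lifting a permutation to the subtree at `1` is injective on the group, but not surjective: every
lift fixes the vertex `1`, which `a` moves. A finite set has no such self-map. -/
theorem infinite_range_run : (Set.range run).Infinite := by
  intro hfin
  have : Finite (Set.range run) := hfin
  let f : Set.range run → Set.range run := fun g => ⟨run (lift g.2.choose), _, rfl⟩
  have hf (g : Set.range run) (u : List (Fin 2)) : (f g).1 (1 :: u) = 1 :: g.1 u := by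
    rw [run_lift_apply, g.2.choose_spec]
  have hinj : Function.Injective f := fun g g' h => by
    refine Subtype.ext (Equiv.ext fun u => ?_)
    have := hf g u
    rw [h, hf] at this
    exact (List.cons.inj this).2.symm
  obtain ⟨g, hg⟩ := Finite.injective_iff_surjective.1 hinj ⟨run [a], _, rfl⟩
  have := hf g []
  rw [hg] at this
  simp [run, prod, perm, grigA] at this

/-- The permutation represented by a word is determined by the action of its iterated sections
on the first level. -/
theorem run_eq_of_img_seqOut_eq {v w : List GrigState}
    (h : ∀ xs x, img x (grigMealy.dual.seqOut xs v) = img x (grigMealy.dual.seqOut xs w)) :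
    run v = run w := by
  ext1 u
  induction u generalizing v w with
  | nil => rw [run_apply_nil, run_apply_nil]
  | cons x u ih =>
    rw [run_apply_cons, run_apply_cons, ih fun xs y => ?_]
    · exact congrArg (· :: _) (h [] x)
    · have (w : List GrigState) : grigMealy.dual.seqOut xs (sec x w) =
          grigMealy.dual.seqOut (xs ++ [x]) w := by
        simp [Mealy.seqOut]
      rw [this, this]
      exact h _ y

theorem infinite_generatedSemigroup_dual :
    Infinite grigMealy.dual.toAutomaton.generatedSemigroup := by
  by_contra hfin
  rw [not_infinite_iff_finite] at hfin
  have h₁ : (Set.range grigMealy.dual.toAutomaton.act).Finite := by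
    have h : (grigMealy.dual.toAutomaton.generatedSemigroup :
      Set (PartialMap (Word GrigState))).Finite := hfin
    -- The semigroup omits the empty sequence, whose map is the identity.
    refine (h.insert (PFun.id _)).subset ?_
    rintro _ ⟨xs, rfl⟩
    by_cases hxs : xs = []
    · subst hxs
      exact .inl rfl
    · exact .inr ⟨xs, hxs, rfl⟩
  have : Finite (Set.range grigMealy.dual.toAutomaton.act) := h₁
  -- `F g` tabulates the first-level images of the sections of a chosen word for `g`, indexed by the
  -- maps of the dual. Its codomain is finite.
  let F : Set.range run → Set.range grigMealy.dual.toAutomaton.act → Fin 2 → Fin 2 :=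
    fun g s x => img x (grigMealy.dual.seqOut s.2.choose g.2.choose)
  have hF : Function.Injective F := fun g g' h => by
    refine Subtype.ext ?_
    rw [← g.2.choose_spec, ← g'.2.choose_spec]
    refine run_eq_of_img_seqOut_eq fun xs x => ?_
    -- The sequence chosen for this map may differ from `xs`, but it acts identically on finite
    -- words.
    let s : Set.range grigMealy.dual.toAutomaton.act := ⟨_, xs, rfl⟩
    have hs : grigMealy.dual.seqOut s.2.choose = grigMealy.dual.seqOut xs := by
      rw [← Mealy.seqMap_eq_iff, ← Mealy.act_eq_iff]
      exact s.2.choose_spec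
    have := congrFun (congrFun h s) x
    simp only [F, hs] at this
    exact this
  exact infinite_range_run (Finite.of_injective F hF)

-- The generated group is the Grigorchuk group

/-- The disjoint union of the Grigorchuk automaton and its inverse, which is the Grigorchuk
automaton itself. -/
def doubleMealy : Mealy (GrigState ⊕ GrigState) (Fin 2) where
  out q := (q.elim id id).out
  nxt q x := q.map (·.nxt x) (·.nxt x)

theorem disjointUnion_eq :
    grigAutomaton.disjointUnion grigAutomaton.inverse = doubleMealy.toAutomaton := by
  rw [grigAutomaton_inverse, grigAutomaton_eq]
  ext ⟨q, x, y, p⟩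
  rw [Mealy.mem_toAutomaton]
  rcases q with q | q <;> rcases p with p | p <;>
    simp [Automaton.disjointUnion, doubleMealy, grigMealy, -Fin.exists_fin_two]

theorem doubleMealy_wordOut (q : GrigState ⊕ GrigState) (u : List (Fin 2)) :
    doubleMealy.wordOut q u = grigMealy.wordOut (q.elim id id) u := by
  induction u generalizing q with
  | nil => rfl
  | cons x u ih =>
    rw [Mealy.wordOut, Mealy.wordOut, ih]
    cases q <;> rfl

theorem doubleMealy_seqOut (qs : List (GrigState ⊕ GrigState)) :
    doubleMealy.seqOut qs = prod (qs.map fun q => q.elim id id) := by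
  funext u
  rw [prod_apply]
  induction qs with
  | nil => rfl
  | cons q qs ih =>
    change doubleMealy.wordOut q (doubleMealy.seqOut qs u) = _
    rw [ih, doubleMealy_wordOut]; rfl

theorem act_doubleMealy_eq_iff {qs qs' : List (GrigState ⊕ GrigState)} :
    doubleMealy.toAutomaton.act qs = doubleMealy.toAutomaton.act qs' ↔
      prod (qs.map fun q => q.elim id id) = prod (qs'.map fun q => q.elim id id) := by
  rw [Mealy.act_eq_iff, Mealy.seqMap_eq_iff, doubleMealy_seqOut, doubleMealy_seqOut]
  exact DFunLike.coe_injective.eq_iff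

/-- The generators are involutions, so inverses are reversed words and positive words suffice. -/
theorem mem_grigorchukGroup_iff {g : Equiv.Perm (List (Fin 2))} :
    g ∈ grigorchukGroup ↔ ∃ w, g = prod w := by
  constructor
  · intro hg
    induction hg using Subgroup.closure_induction with
    | mem g hg =>
      rcases hg with rfl | rfl | rfl | rfl
      exacts [⟨[a], rfl⟩, ⟨[b], rfl⟩, ⟨[c], rfl⟩, ⟨[d], rfl⟩]
    | one => exact ⟨[], rfl⟩
    | mul g h _ _ hg hh =>
      obtain ⟨v, rfl⟩ := hg
      obtain ⟨w, rfl⟩ := hh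
      exact ⟨v ++ w, by simp [prod]⟩
    | inv g _ hg =>
      obtain ⟨w, rfl⟩ := hg
      refine ⟨w.reverse, ?_⟩
      rw [prod, prod, List.prod_inv_reverse, List.map_map, ← List.map_reverse]
      congr 2
      funext q
      exact inv_eq_of_mul_eq_one_left (perm_mul_self q)
  · rintro ⟨w, rfl⟩
    refine Subgroup.list_prod_mem _ fun g hg => ?_
    obtain ⟨q, -, rfl⟩ := List.mem_map.1 hg
    cases q
    · exact Subgroup.subset_closure (.inl rfl)
    · exact Subgroup.subset_closure (.inr (.inl rfl))
    · exact Subgroup.subset_closure (.inr (.inr (.inl rfl)))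
    · exact Subgroup.subset_closure (.inr (.inr (.inr rfl)))
    · exact one_mem _

/-- The generated group is isomorphic to the Grigorchuk group by restriction to finite words. -/
theorem nonempty_generatedGroup_mulEquiv :
    Nonempty (grigAutomaton.generatedGroup ≃* grigorchukGroup) := by
  rw [Automaton.generatedGroup, disjointUnion_eq]
  let T := doubleMealy.toAutomaton
  let r (qs : List (GrigState ⊕ GrigState)) := prod (qs.map fun q => q.elim id id)
  have hr (qs) : r qs ∈ grigorchukGroup := mem_grigorchukGroup_iff.2 ⟨_, rfl⟩
  let f : T.generatedSemigroup → grigorchukGroup := fun s => ⟨r s.2.choose, hr _⟩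
  have hf (s : T.generatedSemigroup) (qs) (h : s.1 = T.act qs) : (f s).1 = r qs :=
    act_doubleMealy_eq_iff.1 (s.2.choose_spec.2.symm.trans h)
  have hmul (s t) : f (s * t) = f s * f t := by
    obtain ⟨_, qs, hqs, rfl⟩ := s
    obtain ⟨_, qs', hqs', rfl⟩ := t
    refine Subtype.ext ?_
    rw [Subgroup.coe_mul, hf _ (qs ++ qs') (T.act_append qs qs').symm, hf _ qs rfl,
      hf _ qs' rfl]
    simp [r, prod]
  refine ⟨MulEquiv.ofBijective (⟨f, hmul⟩ : T.generatedSemigroup →ₙ* grigorchukGroup) ⟨?_, ?_⟩⟩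
  · rintro ⟨_, qs, hqs, rfl⟩ ⟨_, qs', hqs', rfl⟩ h
    have h := congrArg Subtype.val h
    change (f _).1 = (f _).1 at h
    rw [hf _ qs rfl, hf _ qs' rfl] at h
    exact Subtype.ext (act_doubleMealy_eq_iff.2 h)
  · rintro ⟨g, hg⟩
    obtain ⟨w, rfl⟩ := mem_grigorchukGroup_iff.1 hg
    -- The leading `e` keeps the sequence nonempty even when `w` is empty.
    refine ⟨⟨_, .inl e :: w.map .inl, by simp, rfl⟩, Subtype.ext ?_⟩
    refine (hf _ (.inl e :: w.map .inl) rfl).trans ?_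
    have he : e.perm = 1 := rfl
    simp [r, prod, he, Function.comp_def]

end Grig

theorem mainTheorem9 :
    -- the automaton is a `G`-automaton and generates the Grigorchuk group
    (grigAutomaton.IsGAutomaton ∧ Nonempty (grigAutomaton.generatedGroup ≃* grigorchukGroup)) ∧
    -- its dual is the depicted complete and reversible `S`-automaton
    (grigAutomaton.dual = grigDualAutomaton ∧ grigAutomaton.dual.Deterministic ∧
      grigAutomaton.dual.Complete ∧ grigAutomaton.dual.Reversible) ∧
    -- the dual generates an infinite semigroup
    Infinite grigAutomaton.dual.generatedSemigroup ∧
    -- all orbits of ultimately periodic words under the dual are finite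
    ∀ (p q : List GrigState) (hq : q ≠ []),
      (grigAutomaton.dual.orbit (.inr (p ++ₛ Stream'.cycle q hq))).Finite := by
  have hdual : grigAutomaton.dual = grigMealy.dual.toAutomaton := by
    rw [grigAutomaton_eq, Mealy.toAutomaton_dual]
  refine ⟨⟨⟨?_, ?_, ?_⟩, Grig.nonempty_generatedGroup_mulEquiv⟩, ⟨?_, ?_, ?_, ?_⟩, ?_, ?_⟩
  · exact grigAutomaton_eq ▸ grigMealy.toAutomaton_deterministic
  · exact grigAutomaton_eq ▸ grigMealy.toAutomaton_complete
  · rw [grigAutomaton_inverse]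
    exact grigAutomaton_eq ▸ grigMealy.toAutomaton_deterministic
  · exact hdual.trans grigDualAutomaton_eq.symm
  · exact hdual ▸ grigMealy.dual.toAutomaton_deterministic
  · exact hdual ▸ grigMealy.dual.toAutomaton_complete
  · exact hdual.trans grigDualAutomaton_eq.symm ▸ grigDualAutomaton_reversible
  · exact hdual ▸ Grig.infinite_generatedSemigroup_dual
  · exact hdual ▸ Grig.finite_orbit
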